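/- **Corollary 4.2 (KKMS theorem).** Let $k\ge 0$, let $I_{k+1}=\{1,\dots,k+1\}$, and let $\mathcal K$ be the collection of all nonempty subsets of $I_{k+1}$. Let $x_1,\dots,x_{k+1}\in\mathbb R^k$ be the vertices of a (nondegenerate) $k$-simplex, and for $\sigma\in\mathcal K$ let $v_\sigma=\frac1{|\sigma|}\sum_{i\in\sigma}x_i$ be the center of mass of $\{x_i : i\in\sigma\}$. Put $V=\{v_\sigma : \sigma\in\mathcal K\}$ and $c_V=\frac1{|\mathcal K|}\sum_{\sigma\in\mathcal K}v_\sigma$. Call a nonempty $\mathcal B\subset\mathcal K$ *balanced with respect to* $V$ if there are numbers $\lambda_\sigma\ge 0$ ($\sigma\in\mathcal B$) with $\sum_{\sigma\in\mathcal B}\lambda_\sigma=1$ and $\sum_{\sigma\in\mathcal B}\lambda_\sigma v_\sigma=c_V$. Let $\Delta^k=\{p\in\mathbb R^{k+1} : p_i\ge 0,\ \sum_i p_i=1\}$ be the standard $k$-simplex, and for $J\subset I_{k+1}$ let $\Delta_J$ be the face of $\Delta^k$ spanned by its vertices with labels in $J$. Let $\{C_\sigma : \sigma\in\mathcal K\}$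 be a cover of $\Delta^k$ by subsets of $\Delta^k$ that are either all open in $\Delta^k$ or all closed, and suppose that for every $J\subset I_{k+1}$ $$\Delta_J\subset\bigcup_{\sigma\in\mathcal K,\ \sigma\subset J}C_\sigma .$$ Then there is a collection $\mathcal B\subset\mathcal K$, balanced with respect to $V$, such that $$\bigcap_{\sigma\in\mathcal B}C_\sigma\neq\emptyset .$$ -/

import Mathlib

namespace KKMS

/-- A cover of a space `T`: a family of sets with union `T` that is either an open cover
(all members are open) or a closed cover (all members are closed). -/
def IsCover {T I : Type*} [TopologicalSpace T] (C : I → Set T) : Prop :=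
  ((∀ i, IsOpen (C i)) ∨ (∀ i, IsClosed (C i))) ∧ ⋃ i, C i = Set.univ

/-- The center of mass `(1 / m) ∑ v i` of a family of `m` points. -/
noncomputable def center {I E : Type*} [Fintype I] [AddCommGroup E] [Module ℝ E]
    (v : I → E) : E :=
  (Fintype.card I : ℝ)⁻¹ • ∑ i, v i

/-- A nonempty set `B` of labels is balanced with respect to the points `v i`, `i ∈ I`, if the
center of mass of all the points is a convex combination of the `v i` with `i ∈ B`. -/
def IsBalanced {I E : Type*} [Fintype I] [AddCommGroup E] [Module ℝ E]
    (v : I → E) (B : Finset I) : Prop :=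
  B.Nonempty ∧ ∃ l : I → ℝ, (∀ i ∈ B, 0 ≤ l i) ∧ ∑ i ∈ B, l i = 1 ∧
    ∑ i ∈ B, l i • v i = center v

/-- The collection of all nonempty subsets of the vertex labels `Fin (k + 1)`. -/
abbrev NonemptySubset (k : ℕ) : Type := {σ : Finset (Fin (k + 1)) // σ.Nonempty}

/-- The center of mass of the points `x i`, `i ∈ σ`. -/
noncomputable def faceCenter {k : ℕ} {E : Type*} [AddCommGroup E] [Module ℝ E]
    (x : Fin (k + 1) → E) (σ : NonemptySubset k) : E :=
  (σ.1.card : ℝ)⁻¹ • ∑ i ∈ σ.1, x i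

/-- The standard `k`-simplex in `ℝ ^ (k + 1)`, as a space. -/
abbrev Simplex (k : ℕ) : Type := stdSimplex ℝ (Fin (k + 1))

/-- The face of the standard `k`-simplex that is spanned by the vertices with labels in `J`. -/
def face {k : ℕ} (J : Finset (Fin (k + 1))) : Set (Simplex k) :=
  {p | (p : Fin (k + 1) → ℝ) ∈
    convexHull ℝ ((fun i : Fin (k + 1) => (Pi.single i 1 : Fin (k + 1) → ℝ)) '' J)}

end KKMS

/-!
The heart of the matter is a surjectivity statement for a `C¹` self-map `f` of a simplex `K` that
maps each face into itself: every interior point `y` of `K` is a value of `f`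
(`exists_mem_convexHull_eq_of_coord_eq_zero`). It takes the place of Brouwer's theorem, and its
proof is by integration. Put `f_t x = x + t (f x - x)`. For small `t > 0` the map `f_t` is
injective with positive Jacobian and maps the interior `U` of `K` onto itself, so that
`∫_U w (f_t x) det (D f_t x) = ∫_U w x` for all `w`. If `w x = p (‖x - y‖²)` with a polynomial
`p`, the left side is a polynomial in `t`; being constant for small `t > 0`, it has the same value
at `t = 1`:
`∫_U p (‖f x - y‖²) det (D f x) = ∫_U p (‖x - y‖²)`
(`integral_eval_norm_sub_sq_mul_det_fderiv`). If `f` missed `y`, hence a ball around `y`, then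
by the Weierstrass theorem `p` could be taken uniformly close to a bump function which vanishes
at all the values `‖f x - y‖²`, and the left side would be near `0` while the right side is not.

For an open family `C σ` of the KKMS theorem, choose smooth functions `w σ ≥ 0` that are nonzero
exactly on `C σ`, put `φ σ p = w σ p * ∏ i ∈ σ, p i`, and let `f` be the average of the centers
`v σ` with weights proportional to `φ σ`. The product makes `φ σ` vanish at `p` unless `σ` is
contained in the support of `p`, so that `f` preserves faces; the covering condition on the faces
says exactly that some `φ σ` is positive at `p`. The point `c_V` is interior, so `f p = c_V` for
some `p`, and the family of all `σ` with `φ σ p ≠ 0` is balanced, with `p` in every `C σ`. A closed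
family is approximated by its open thickenings.
-/

open MeasureTheory Set Polynomial Filter Topology

/-! ### Families of polynomials in a real parameter -/

/-- The integral of a family of polynomials of bounded degree is again a polynomial in the
parameter, so it is constant if it is constant on an interval. Lagrange interpolation at nodes in
that interval gives this without forming the integrated polynomial. -/
theorem integral_eval_eq_of_forall_mem_Ioo {X : Type*} [MeasurableSpace X] {μ : Measure X}
    {Q : X → ℝ[X]} {d : ℕ} (hQ : ∀ x, (Q x).natDegree ≤ d)
    (hint : ∀ t, Integrable (fun x => (Q x).eval t) μ) {ε V : ℝ} (hε : 0 < ε)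
    (h : ∀ t ∈ Ioo 0 ε, ∫ x, (Q x).eval t ∂μ = V) (t : ℝ) :
    ∫ x, (Q x).eval t ∂μ = V := by
  -- `d + 1` equidistant nodes inside `(0, ε)`.
  let v : ℕ → ℝ := fun j => ε * ((j + 1) / (d + 2))
  let s := Finset.range (d + 1)
  have hd : (0 : ℝ) < d + 2 := by positivity
  have hv : InjOn v s := by
    intro i _ j _ hij
    have := mul_left_cancel₀ hε.ne' hij
    rw [div_left_inj' hd.ne'] at this
    exact_mod_cast add_right_cancel this
  have hvmem : ∀ i ∈ s, v i ∈ Ioo 0 ε := by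
    intro i hi
    have hi' : (i : ℝ) < d + 1 := by exact_mod_cast Finset.mem_range.1 hi
    refine ⟨by positivity, mul_lt_of_lt_one_right hε ?_⟩
    rw [div_lt_one hd]
    linarith
  have hlagrange : ∀ p : ℝ[X], p.natDegree ≤ d →
      p.eval t = ∑ i ∈ s, p.eval (v i) * (Lagrange.basis s v i).eval t := by
    intro p hp
    have hdeg : p.degree < s.card := by
      rw [Finset.card_range]
      exact degree_le_natDegree.trans_lt (by exact_mod_cast Nat.lt_succ_of_le hp)
    conv_lhs => rw [Lagrange.eq_interpolate hv hdeg, Lagrange.interpolate_apply]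
    simp [eval_finsetSum]
  calc ∫ x, (Q x).eval t ∂μ
      = ∫ x, ∑ i ∈ s, (Q x).eval (v i) * (Lagrange.basis s v i).eval t ∂μ := by
        simp_rw [fun x => hlagrange (Q x) (hQ x)]
    _ = ∑ i ∈ s, V * (Lagrange.basis s v i).eval t := by
        rw [integral_finsetSum _ fun i _ => (hint (v i)).mul_const _]
        refine Finset.sum_congr rfl fun i hi => ?_
        rw [integral_mul_const, h _ (hvmem i hi)]
    _ = V := by
        have := hlagrange (C V) (by simp)
        simpa using this.symm

theorem exists_polynomial_eval_eq_matrix_det_one_add_smul {n : ℕ}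
    (M : Matrix (Fin n) (Fin n) ℝ) :
    ∃ q : ℝ[X], q.natDegree ≤ n ∧ ∀ t : ℝ, q.eval t = (1 + t • M).det := by
  have hdeg := natDegree_det_X_add_C_le M 1
  rw [Fintype.card_fin] at hdeg
  refine ⟨_, hdeg, fun t => ?_⟩
  rw [_root_.eval_det, matPolyEquiv_eval_eq_map]
  refine congrArg Matrix.det (Matrix.ext fun i j => ?_)
  by_cases h : i = j
  · subst h
    simp [add_comm]
    ring
  · simp [h]
    ring

theorem exists_polynomial_eval_eq_det_one_add_smul {E : Type*} [NormedAddCommGroup E]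
    [NormedSpace ℝ E] [FiniteDimensional ℝ E] (A : E →L[ℝ] E) :
    ∃ q : ℝ[X], q.natDegree ≤ Module.finrank ℝ E ∧
      ∀ t : ℝ, q.eval t = (1 + t • A : E →L[ℝ] E).det := by
  let e := Module.finBasis ℝ E
  obtain ⟨q, hdeg, hq⟩ := exists_polynomial_eval_eq_matrix_det_one_add_smul
    (LinearMap.toMatrix e e (A : E →ₗ[ℝ] E))
  refine ⟨q, hdeg, fun t => ?_⟩
  rw [hq, ContinuousLinearMap.det, ← LinearMap.det_toMatrix e,
    ContinuousLinearMap.toLinearMap_add, ContinuousLinearMap.toLinearMap_smul, map_add, map_smul]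
  exact congrArg (fun N => (N + t • LinearMap.toMatrix e e (A : E →ₗ[ℝ] E)).det)
    (LinearMap.toMatrix_one e).symm

theorem exists_polynomial_eval_eq_norm_add_smul_sq {E : Type*} [NormedAddCommGroup E]
    [InnerProductSpace ℝ E] (u w : E) :
    ∃ q : ℝ[X], q.natDegree ≤ 2 ∧ ∀ t : ℝ, q.eval t = ‖u + t • w‖ ^ 2 := by
  refine ⟨C (‖w‖ ^ 2) * X ^ 2 + C (2 * inner ℝ u w) * X + C (‖u‖ ^ 2),
    natDegree_quadratic_le, fun t => ?_⟩
  rw [norm_add_sq_real, inner_smul_right, norm_smul, mul_pow, Real.norm_eq_abs, sq_abs]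
  simp
  ring

/-! ### Small deformations of the identity that preserve the faces of a simplex -/

section Deformation

variable {ι E : Type*} [Fintype ι] [NormedAddCommGroup E] [NormedSpace ℝ E]
  {b : AffineBasis ι ℝ E} {f : E → E}

/-- The barycentric coordinates of `x + t (f x - x)` are `(1 - t) x_i + t (f x)_i`, and the first
term is positive at an interior point. -/
theorem add_smul_sub_mem_interior_convexHull
    (hmaps : MapsTo f (convexHull ℝ (range b)) (convexHull ℝ (range b))) {x : E}
    (hx : x ∈ interior (convexHull ℝ (range b))) {t : ℝ} (ht : t ∈ Ico (0 : ℝ) 1) :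
    x + t • (f x - x) ∈ interior (convexHull ℝ (range b)) := by
  have hfx := hmaps (interior_subset hx)
  rw [b.interior_convexHull] at hx ⊢
  rw [b.convexHull_eq_nonneg_coord] at hfx
  intro i
  have h : b.coord i (x + t • (f x - x)) = b.coord i x + t * (b.coord i (f x) - b.coord i x) := by
    have := (b.coord i).apply_lineMap x (f x) t
    rw [AffineMap.lineMap_apply, AffineMap.lineMap_apply] at this
    simpa [add_comm] using this
  rw [h]
  have h1 := hx i
  have h2 := mul_nonneg ht.1 (hfx i)
  have h3 := mul_pos (sub_pos.2 ht.2) h1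
  linarith

theorem exists_coord_eq_zero_of_mem_diff_interior {x : E}
    (hx : x ∈ convexHull ℝ (range b)) (hx' : x ∉ interior (convexHull ℝ (range b))) :
    ∃ i, b.coord i x = 0 := by
  rw [b.interior_convexHull] at hx'
  rw [b.convexHull_eq_nonneg_coord] at hx
  by_contra! h
  exact hx' fun i => (hx i).lt_of_ne' (h i)

theorem injOn_add_smul_of_lipschitzOnWith {K : Set E} {g : E → E} {L : NNReal}
    (hg : LipschitzOnWith L g K) {t : ℝ} (ht0 : 0 ≤ t) (ht : t * L < 1) :
    InjOn (fun x => x + t • g x) K := by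
  intro x hx y hy hxy
  have h : x - y = t • (g y - g x) := by
    have : x + t • g x = y + t • g y := hxy
    rw [smul_sub, sub_eq_sub_iff_add_eq_add, this, add_comm]
  have h2 := hg.dist_le_mul x hx y hy
  by_contra hne
  have hpos : 0 < ‖x - y‖ := norm_pos_iff.2 (sub_ne_zero.2 hne)
  have h3 : ‖x - y‖ = t * dist (g x) (g y) := by
    conv_lhs => rw [h]
    rw [norm_smul, Real.norm_of_nonneg ht0, dist_comm, dist_eq_norm]
  rw [dist_eq_norm x y] at h2
  nlinarith [mul_le_mul_of_nonneg_left h2 ht0]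

/-- The determinant is positive near the identity; the content here is that the bound on `t` is
uniform over a bounded set of operators. -/
theorem exists_forall_det_one_add_smul_pos [FiniteDimensional ℝ E] (M : ℝ) :
    ∃ ε : ℝ, 0 < ε ∧ ∀ A : E →L[ℝ] E, ‖A‖ ≤ M → ∀ t ∈ Ioo 0 ε, 0 < (1 + t • A : E →L[ℝ] E).det := by
  have hcont : Continuous fun A : E →L[ℝ] E => A.det := ContinuousLinearMap.continuous_det
  have h1 : (1 : E →L[ℝ] E).det = 1 := LinearMap.det_id
  have hev : ∀ᶠ A : E →L[ℝ] E in 𝓝 1, 0 < A.det :=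
    hcont.continuousAt.eventually (lt_mem_nhds (one_pos.trans_eq h1.symm))
  obtain ⟨δ, hδ, hball⟩ := Metric.eventually_nhds_iff.1 hev
  refine ⟨δ / (|M| + 1), by positivity, fun A hA t ht => hball ?_⟩
  rw [dist_eq_norm, add_sub_cancel_left, norm_smul, Real.norm_of_nonneg ht.1.le]
  have h2 := (lt_div_iff₀ (by positivity)).1 ht.2
  have h3 : ‖A‖ ≤ |M| + 1 := hA.trans ((le_abs_self M).trans (by linarith))
  exact (mul_le_mul_of_nonneg_left h3 ht.1.le).trans_lt h2

/-- The image of the interior of the simplex under the deformed map is open by the inverse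
function theorem, and closed relative to the interior because boundary points stay in their
facets. Connectedness makes it the whole interior. -/
theorem image_interior_convexHull_eq [FiniteDimensional ℝ E]
    (hmaps : MapsTo f (convexHull ℝ (range b)) (convexHull ℝ (range b)))
    (hcoord : ∀ x ∈ convexHull ℝ (range b), ∀ i, b.coord i x = 0 → b.coord i (f x) = 0)
    (hf : ∀ x ∈ convexHull ℝ (range b), ContDiffAt ℝ 1 f x) {t : ℝ} (ht : t ∈ Ico (0 : ℝ) 1)
    (hdet : ∀ x ∈ convexHull ℝ (range b), (1 + t • (fderiv ℝ f x - 1) : E →L[ℝ] E).det ≠ 0) :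
    (fun x => x + t • (f x - x)) '' interior (convexHull ℝ (range b)) =
      interior (convexHull ℝ (range b)) := by
  set K := convexHull ℝ (range b) with hK
  set F := fun x => x + t • (f x - x) with hF
  have hKc : IsCompact K := (finite_range b).isCompact_convexHull ℝ
  have hFcont : ContinuousOn F K := by
    have := ContinuousOn.mono (fun x hx => (hf x hx).continuousAt.continuousWithinAt) subset_rfl
    fun_prop
  have hsub : F '' interior K ⊆ interior K := by
    rintro _ ⟨x, hx, rfl⟩
    exact add_smul_sub_mem_interior_convexHull hmaps hx ht
  have hopen : IsOpen (F '' interior K) := by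
    rw [isOpen_iff_mem_nhds]
    rintro _ ⟨x, hx, rfl⟩
    have hxK := interior_subset hx
    have hd : HasStrictFDerivAt F (1 + t • (fderiv ℝ f x - 1) : E →L[ℝ] E) x :=
      (hasStrictFDerivAt_id x).add
        ((((hf x hxK).hasStrictFDerivAt one_ne_zero).sub (hasStrictFDerivAt_id x)).const_smul t)
    have hmap := HasStrictFDerivAt.map_nhds_eq_of_equiv
      (f' := ContinuousLinearMap.toContinuousLinearEquivOfDetNeZero _ (hdet x hxK)) hd
    rw [← hmap]
    exact image_mem_map (isOpen_interior.mem_nhds hx)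
  refine hsub.antisymm ?_
  rcases (interior K).eq_empty_or_nonempty with hempty | ⟨x₀, hx₀⟩
  · rw [hempty]; exact empty_subset _
  refine ((convex_convexHull ℝ _).interior.isPreconnected).subset_of_closure_inter_subset hopen
    ⟨F x₀, hsub ⟨x₀, hx₀, rfl⟩, x₀, hx₀, rfl⟩ ?_
  rintro y ⟨hy, hyint⟩
  obtain ⟨x, hx, rfl⟩ : y ∈ F '' K :=
    closure_minimal (image_mono interior_subset) (hKc.image_of_continuousOn hFcont).isClosed hy
  refine ⟨x, ?_, rfl⟩
  by_contra hxint
  obtain ⟨i, hi⟩ := exists_coord_eq_zero_of_mem_diff_interior hx hxint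
  rw [b.interior_convexHull] at hyint
  have h := (b.coord i).apply_lineMap x (f x) t
  rw [AffineMap.lineMap_apply, AffineMap.lineMap_apply, hi, hcoord x hx i hi] at h
  have h0 : b.coord i (F x) = 0 := by simpa [hF, add_comm] using h
  exact (hyint i).ne' h0

/-- Change of variables for the maps `x ↦ x + t (f x - x)` with small `t`, which permute the
interior of the simplex. -/
theorem exists_forall_integral_comp_mul_det_eq [FiniteDimensional ℝ E]
    [MeasurableSpace E] [BorelSpace E] (μ : Measure E) [μ.IsAddHaarMeasure]
    (hmaps : MapsTo f (convexHull ℝ (range b)) (convexHull ℝ (range b)))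
    (hcoord : ∀ x ∈ convexHull ℝ (range b), ∀ i, b.coord i x = 0 → b.coord i (f x) = 0)
    (hf : ∀ x ∈ convexHull ℝ (range b), ContDiffAt ℝ 1 f x) :
    ∃ ε : ℝ, 0 < ε ∧ ∀ t ∈ Ioo 0 ε, ∀ w : E → ℝ,
      ∫ x in interior (convexHull ℝ (range b)),
        w (x + t • (f x - x)) * (1 + t • (fderiv ℝ f x - 1) : E →L[ℝ] E).det ∂μ =
      ∫ x in interior (convexHull ℝ (range b)), w x ∂μ := by
  set K := convexHull ℝ (range b) with hK
  have hKc : IsCompact K := (finite_range b).isCompact_convexHull ℝ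
  have hdcont : ContinuousOn (fun x => fderiv ℝ f x - 1) K := fun x hx =>
    (((hf x hx).continuousAt_fderiv one_ne_zero).sub continuousAt_const).continuousWithinAt
  obtain ⟨M, hM⟩ := hKc.exists_bound_of_continuousOn hdcont
  obtain ⟨L, hL⟩ : ∃ L, LipschitzOnWith L (fun x => f x - x) K :=
    ContDiffOn.exists_lipschitzOnWith (n := 1)
      (fun x hx => ((hf x hx).sub contDiffAt_id).contDiffWithinAt) one_ne_zero
      (convex_convexHull ℝ _) hKc
  obtain ⟨ε, hε, hpos⟩ := exists_forall_det_one_add_smul_pos (E := E) M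
  refine ⟨min ε (min 1 (1 / (L + 1))), by positivity, fun t ht w => ?_⟩
  have htε : t ∈ Ioo 0 ε := ⟨ht.1, ht.2.trans_le (min_le_left _ _)⟩
  have ht1 : t < 1 := ht.2.trans_le ((min_le_right _ _).trans (min_le_left _ _))
  have htL : t * L < 1 := by
    have h := ht.2.trans_le ((min_le_right _ _).trans (min_le_right _ _))
    rw [lt_div_iff₀ (by positivity)] at h
    linarith [ht.1]
  have hdet : ∀ x ∈ K, 0 < (1 + t • (fderiv ℝ f x - 1) : E →L[ℝ] E).det :=
    fun x hx => hpos _ (hM x hx) t htε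
  have himage := image_interior_convexHull_eq hmaps hcoord hf ⟨ht.1.le, ht1⟩
    fun x hx => (hdet x hx).ne'
  have hderiv : ∀ x ∈ interior K, HasFDerivWithinAt (fun x => x + t • (f x - x))
      (1 + t • (fderiv ℝ f x - 1) : E →L[ℝ] E) (interior K) x := fun x hx =>
    ((hasFDerivAt_id x).add
      (((((hf x (interior_subset hx)).differentiableAt one_ne_zero).hasFDerivAt).sub
        (hasFDerivAt_id x)).const_smul t)).hasFDerivWithinAt
  have hinj := (injOn_add_smul_of_lipschitzOnWith hL ht.1.le htL).mono interior_subset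
  -- The image of the interior is the interior, so the left side of this is the plain integral.
  have hcv := integral_image_eq_integral_abs_det_fderiv_smul μ isOpen_interior.measurableSet
    hderiv hinj w
  rw [himage] at hcv
  rw [hcv]
  refine setIntegral_congr_fun isOpen_interior.measurableSet fun x hx => ?_
  rw [abs_of_pos (hdet x (interior_subset hx)), smul_eq_mul, mul_comm]

end Deformation

/-! ### Surjectivity of face-preserving maps -/

section Surjectivity

variable {ι E : Type*} [Fintype ι] [NormedAddCommGroup E] [InnerProductSpace ℝ E]
  [FiniteDimensional ℝ E] [MeasurableSpace E] [BorelSpace E] {b : AffineBasis ι ℝ E} {f : E → E}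

/-- The change of variables formula persists from the maps `x ↦ x + t (f x - x)` with small `t`
to `f` itself, without absolute value on the Jacobian, because both sides are polynomials
in `t` for the weights considered here. -/
theorem integral_eval_norm_sub_sq_mul_det_fderiv (μ : Measure E) [μ.IsAddHaarMeasure]
    (hmaps : MapsTo f (convexHull ℝ (range b)) (convexHull ℝ (range b)))
    (hcoord : ∀ x ∈ convexHull ℝ (range b), ∀ i, b.coord i x = 0 → b.coord i (f x) = 0)
    (hf : ∀ x ∈ convexHull ℝ (range b), ContDiffAt ℝ 1 f x) (y : E) (p : ℝ[X]) :
    ∫ x in interior (convexHull ℝ (range b)),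
      p.eval (‖f x - y‖ ^ 2) * (fderiv ℝ f x).det ∂μ =
    ∫ x in interior (convexHull ℝ (range b)), p.eval (‖x - y‖ ^ 2) ∂μ := by
  set K := convexHull ℝ (range b) with hK
  have hKc : IsCompact K := (finite_range b).isCompact_convexHull ℝ
  obtain ⟨ε, hε, h⟩ := exists_forall_integral_comp_mul_det_eq μ hmaps hcoord hf
  choose q hqdeg hq using fun x => exists_polynomial_eval_eq_norm_add_smul_sq (x - y) (f x - x)
  choose d hddeg hd using fun x =>
    exists_polynomial_eval_eq_det_one_add_smul (fderiv ℝ f x - 1)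
  have heval : ∀ x t, (p.comp (q x) * d x).eval t =
      p.eval (‖x + t • (f x - x) - y‖ ^ 2) * (1 + t • (fderiv ℝ f x - 1) : E →L[ℝ] E).det := by
    intro x t
    rw [eval_mul, eval_comp, hq, hd, sub_add_eq_add_sub]
  have hfc : ContinuousOn f K := fun x hx => (hf x hx).continuousAt.continuousWithinAt
  have hdc : ContinuousOn (fderiv ℝ f) K := fun x hx =>
    ((hf x hx).continuousAt_fderiv one_ne_zero).continuousWithinAt
  -- The integrand has degree at most `2 * deg p + dim E` in `t`.
  have key := integral_eval_eq_of_forall_mem_Ioo (μ := μ.restrict (interior K))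
    (Q := fun x => p.comp (q x) * d x) (d := p.natDegree * 2 + Module.finrank ℝ E)
    (V := ∫ x in interior K, p.eval (‖x - y‖ ^ 2) ∂μ) ?_ ?_ hε ?_ 1
  · simpa only [heval, one_smul, add_sub_cancel] using key
  · intro x
    refine natDegree_mul_le.trans (add_le_add (natDegree_comp_le.trans ?_) (hddeg x))
    exact Nat.mul_le_mul_left _ (hqdeg x)
  · intro t
    simp_rw [heval]
    refine IntegrableOn.mono_set (ContinuousOn.integrableOn_compact hKc ?_) interior_subset
    refine ContinuousOn.mul (p.continuous.comp_continuousOn (by fun_prop)) ?_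
    exact ContinuousLinearMap.continuous_det.comp_continuousOn (by fun_prop)
  · intro t ht
    simp_rw [heval]
    exact h t ht fun x => p.eval (‖x - y‖ ^ 2)

/-- A `C¹` map of a simplex to itself that preserves all facets, hence all faces, takes every
interior point as a value. -/
theorem exists_mem_convexHull_eq_of_coord_eq_zero
    (hmaps : MapsTo f (convexHull ℝ (range b)) (convexHull ℝ (range b)))
    (hcoord : ∀ x ∈ convexHull ℝ (range b), ∀ i, b.coord i x = 0 → b.coord i (f x) = 0)
    (hf : ∀ x ∈ convexHull ℝ (range b), ContDiffAt ℝ 1 f x) {y : E}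
    (hy : y ∈ interior (convexHull ℝ (range b))) :
    ∃ x ∈ convexHull ℝ (range b), f x = y := by
  have hident := integral_eval_norm_sub_sq_mul_det_fderiv volume hmaps hcoord hf y
  set K := convexHull ℝ (range b) with hK
  set U := interior K with hU
  have hKc : IsCompact K := (finite_range b).isCompact_convexHull ℝ
  have hfc : ContinuousOn f K := fun x hx => (hf x hx).continuousAt.continuousWithinAt
  have hdc : ContinuousOn (fderiv ℝ f) K := fun x hx =>
    ((hf x hx).continuousAt_fderiv one_ne_zero).continuousWithinAt
  have hJc : ContinuousOn (fun x => (fderiv ℝ f x).det) K :=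
    ContinuousLinearMap.continuous_det.comp_continuousOn hdc
  have hint : ∀ {g : E → ℝ}, ContinuousOn g K → IntegrableOn g U := fun hg =>
    (hg.integrableOn_compact hKc).mono_set interior_subset
  by_contra! hne
  obtain ⟨x₀, hx₀, hmin⟩ := hKc.exists_isMinOn ⟨y, interior_subset hy⟩
    (f := fun x => ‖f x - y‖ ^ 2) (by fun_prop)
  have hr : 0 < ‖f x₀ - y‖ ^ 2 := by
    have := norm_pos_iff.2 (sub_ne_zero.2 (hne x₀ hx₀))
    positivity
  set r := ‖f x₀ - y‖ ^ 2 with hrdef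
  obtain ⟨D, hD⟩ := hKc.exists_bound_of_continuousOn (f := fun x => ‖x - y‖ ^ 2) (by fun_prop)
  have hIcc : ∀ x ∈ K, ‖x - y‖ ^ 2 ∈ Icc 0 D := fun x hx =>
    ⟨by positivity, (le_abs_self _).trans (hD x hx)⟩
  -- The bump `h (‖· - y‖ ^ 2)` is positive at `y` and vanishes on the image of `f`.
  set h : ℝ → ℝ := fun s => max 0 (r - s) with hh
  have hhc : Continuous h := by fun_prop
  have hh0 : ∀ s, 0 ≤ h s := fun s => le_max_left _ _
  set A := ∫ x in U, h (‖x - y‖ ^ 2) with hA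
  have hApos : 0 < A := by
    rw [hA, setIntegral_pos_iff_support_of_nonneg_ae
      (Eventually.of_forall fun x => hh0 (‖x - y‖ ^ 2)) (hint (by fun_prop))]
    have hopen : IsOpen ((Function.support fun x => h (‖x - y‖ ^ 2)) ∩ U) :=
      (Continuous.isOpen_support (by fun_prop)).inter isOpen_interior
    refine hopen.measure_pos _ ⟨y, ?_, hy⟩
    simp [hh, hr.le, hr.ne']
  set J := ∫ x in U, |(fderiv ℝ f x).det| with hJ
  set V := ∫ _x in U, (1 : ℝ) with hV
  have hJ0 : 0 ≤ J := integral_nonneg fun x => abs_nonneg _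
  have hV0 : 0 ≤ V := integral_nonneg fun x => zero_le_one
  set ε := A / (J + V + 1) with hε
  obtain ⟨p, hp⟩ := exists_polynomial_near_of_continuousOn 0 D h hhc.continuousOn ε (by positivity)
  have hpc := p.continuous
  have h1 : A ≤ (∫ x in U, p.eval (‖x - y‖ ^ 2)) + ε * V := by
    rw [hV, ← integral_const_mul, ← integral_add (hint (by fun_prop)) (hint (by fun_prop))]
    refine setIntegral_mono_on (hint (by fun_prop)) (hint (by fun_prop))
      isOpen_interior.measurableSet fun x hx => ?_
    have := (abs_lt.1 (hp _ (hIcc x (interior_subset hx)))).1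
    linarith
  have h2 : (∫ x in U, p.eval (‖f x - y‖ ^ 2) * (fderiv ℝ f x).det) ≤ ε * J := by
    rw [hJ, ← integral_const_mul]
    refine setIntegral_mono_on (hint (by fun_prop)) (hint (by fun_prop))
      isOpen_interior.measurableSet fun x hx => ?_
    have hx' := interior_subset hx
    have h3 := hp _ (hIcc (f x) (hmaps hx'))
    have h4 : h (‖f x - y‖ ^ 2) = 0 := max_eq_left (sub_nonpos.2 (hmin hx'))
    rw [h4, sub_zero] at h3
    refine (le_abs_self _).trans ?_
    rw [abs_mul]
    exact mul_le_mul_of_nonneg_right h3.le (abs_nonneg _)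
  rw [hident p] at h2
  have h5 : ε * (J + V + 1) = A := div_mul_cancel₀ _ (by positivity)
  have h6 : 0 < ε := by positivity
  linarith

end Surjectivity

/-! ### Barycentric coordinates of the centers -/

theorem AffineMap.apply_sum_smul_of_sum_eq_one {α E : Type*} [AddCommGroup E] [Module ℝ E]
    (g : E →ᵃ[ℝ] ℝ) (s : Finset α) (l : α → ℝ) (v : α → E) (hl : ∑ a ∈ s, l a = 1) :
    g (∑ a ∈ s, l a • v a) = ∑ a ∈ s, l a * g (v a) := by
  rw [← s.affineCombination_eq_linear_combination v l hl, s.map_affineCombination v l hl,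
    s.affineCombination_eq_linear_combination _ l hl]
  rfl

namespace KKMS

theorem mem_face_of_forall_notMem {k : ℕ} (p : Simplex k) (J : Finset (Fin (k + 1)))
    (h : ∀ i ∉ J, (p : Fin (k + 1) → ℝ) i = 0) : p ∈ face J := by
  have hsum : ∑ i ∈ J, (p : Fin (k + 1) → ℝ) i = 1 := by
    rw [Finset.sum_subset J.subset_univ fun i _ hi => h i hi]
    exact p.2.2
  have hp : (p : Fin (k + 1) → ℝ) = ∑ i ∈ J, (p : Fin (k + 1) → ℝ) i • Pi.single i (1 : ℝ) := by
    rw [Finset.sum_subset J.subset_univ fun i _ hi => by rw [h i hi, zero_smul]]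
    exact pi_eq_sum_univ' _
  change (p : Fin (k + 1) → ℝ) ∈ convexHull ℝ _
  rw [hp]
  exact (convex_convexHull ℝ _).sum_mem (fun i _ => p.2.1 i) hsum
    fun i hi => subset_convexHull ℝ _ ⟨i, hi, rfl⟩

section Coordinates

variable {k : ℕ} {E : Type*} [AddCommGroup E] [Module ℝ E]
  (b : AffineBasis (Fin (k + 1)) ℝ E)

theorem sum_inv_card (σ : NonemptySubset k) : ∑ _i ∈ σ.1, (σ.1.card : ℝ)⁻¹ = 1 := by
  have := σ.2.card_pos
  rw [Finset.sum_const, nsmul_eq_mul, mul_inv_cancel₀ (by positivity)]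

theorem coord_faceCenter (σ : NonemptySubset k) (j : Fin (k + 1)) :
    b.coord j (faceCenter b σ) = if j ∈ σ.1 then (σ.1.card : ℝ)⁻¹ else 0 := by
  rw [faceCenter, Finset.smul_sum, AffineMap.apply_sum_smul_of_sum_eq_one _ _ _ _ (sum_inv_card σ)]
  simp [AffineBasis.coord_apply]

theorem coord_faceCenter_nonneg (σ : NonemptySubset k) (j : Fin (k + 1)) :
    0 ≤ b.coord j (faceCenter b σ) := by
  rw [coord_faceCenter]
  positivity

theorem coord_center_pos (j : Fin (k + 1)) : 0 < b.coord j (center (faceCenter b)) := by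
  let τ : NonemptySubset k := ⟨{j}, Finset.singleton_nonempty j⟩
  have hcard : (0 : ℝ) < Fintype.card (NonemptySubset k) := by
    exact_mod_cast Fintype.card_pos_iff.2 ⟨τ⟩
  rw [center, Finset.smul_sum, AffineMap.apply_sum_smul_of_sum_eq_one]
  · refine Finset.sum_pos' (fun σ _ => mul_nonneg (by positivity) (coord_faceCenter_nonneg b σ j))
      ⟨τ, Finset.mem_univ _, ?_⟩
    rw [coord_faceCenter]
    simpa [τ] using hcard
  · rw [Finset.sum_const, nsmul_eq_mul, Finset.card_univ, mul_inv_cancel₀ hcard.ne']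

end Coordinates

/-! ### The KKMS theorem -/

/-- The KKMS theorem for open families: the weights `φ σ = w σ * ∏ i ∈ σ, b.coord i` define a
face-preserving map, and a point which it sends to the center has a balanced set of labels. -/
theorem exists_isBalanced_of_isOpen {k : ℕ} {E : Type*} [NormedAddCommGroup E]
    [InnerProductSpace ℝ E] [FiniteDimensional ℝ E] (b : AffineBasis (Fin (k + 1)) ℝ E)
    (C : NonemptySubset k → Set (Simplex k)) (hC : ∀ σ, IsOpen (C σ))
    (hface : ∀ J : Finset (Fin (k + 1)),
      face J ⊆ ⋃ σ : NonemptySubset k, ⋃ _ : σ.1 ⊆ J, C σ) :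
    ∃ B : Finset (NonemptySubset k),
      IsBalanced (faceCenter b) B ∧ (⋂ σ ∈ B, C σ).Nonempty := by
  borelize E
  set K := convexHull ℝ (range b) with hK
  have hmemK : ∀ p, p ∈ K ↔ ∀ i, 0 ≤ b.coord i p := fun p => by
    rw [hK, b.convexHull_eq_nonneg_coord]; rfl
  have hcoordC : ∀ i, ContDiff ℝ 1 (b.coord i) := fun i =>
    (smooth_barycentric_coord b i).of_le le_top
  let e : E → Fin (k + 1) → ℝ := fun p i => b.coord i p
  have he : Continuous e := continuous_pi fun i => (hcoordC i).continuous
  choose O hO hCO using fun σ => isOpen_induced_iff.1 (hC σ)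
  -- `w σ` is smooth and nonzero exactly on the set of points with coordinates in `C σ`.
  choose w hwsupp hwdiff hwrange using fun σ =>
    ((hO σ).preimage he).exists_contDiff_support_eq (n := 1)
  have hw0 : ∀ σ p, 0 ≤ w σ p := fun σ p => (hwrange σ ⟨p, rfl⟩).1
  let φ : NonemptySubset k → E → ℝ := fun σ p => w σ p * ∏ i ∈ σ.1, b.coord i p
  let S : E → ℝ := fun p => ∑ σ, φ σ p
  let f : E → E := fun p => ∑ σ, (φ σ p / S p) • faceCenter b σ
  have hφdiff : ∀ σ, ContDiff ℝ 1 (φ σ) := fun σ =>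
    (hwdiff σ).mul (contDiff_prod fun i _ => hcoordC i)
  have hφ0 : ∀ σ, ∀ p ∈ K, 0 ≤ φ σ p := fun σ p hp =>
    mul_nonneg (hw0 σ p) (Finset.prod_nonneg fun i _ => (hmemK p).1 hp i)
  let s : ∀ p ∈ K, Simplex k := fun p hp => ⟨e p, (hmemK p).1 hp, b.sum_coord_apply_eq_one p⟩
  have hmemC : ∀ σ p (hp : p ∈ K), w σ p ≠ 0 ↔ s p hp ∈ C σ := fun σ p hp => by
    rw [← Function.mem_support, hwsupp, ← hCO]; rfl
  have hS : ∀ p ∈ K, 0 < S p := by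
    intro p hp
    -- The covering condition is applied to the smallest face that contains `p`.
    let J : Finset (Fin (k + 1)) := Finset.univ.filter fun i => b.coord i p ≠ 0
    have hmem := hface J (mem_face_of_forall_notMem (s p hp) J fun i hi => by
      by_contra hne
      exact hi (Finset.mem_filter.2 ⟨Finset.mem_univ _, hne⟩))
    simp only [mem_iUnion] at hmem
    obtain ⟨σ, hσJ, hσ⟩ := hmem
    refine Finset.sum_pos' (fun τ _ => hφ0 τ p hp) ⟨σ, Finset.mem_univ _, ?_⟩
    refine (hφ0 σ p hp).lt_of_ne' (mul_ne_zero ((hmemC σ p hp).2 hσ) ?_)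
    exact Finset.prod_ne_zero_iff.2 fun i hi => (Finset.mem_filter.1 (hσJ hi)).2
  have hl0 : ∀ σ, ∀ p ∈ K, 0 ≤ φ σ p / S p := fun σ p hp => div_nonneg (hφ0 σ p hp) (hS p hp).le
  have hl1 : ∀ p ∈ K, ∑ σ, φ σ p / S p = 1 := fun p hp => by
    rw [← Finset.sum_div, div_self (hS p hp).ne']
  have hfcoord : ∀ p ∈ K, ∀ j, b.coord j (f p) = ∑ σ, φ σ p / S p * b.coord j (faceCenter b σ) :=
    fun p hp j => AffineMap.apply_sum_smul_of_sum_eq_one _ _ _ _ (hl1 p hp)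
  have hmaps : MapsTo f K K := fun p hp => (hmemK _).2 fun j => by
    rw [hfcoord p hp]
    exact Finset.sum_nonneg fun σ _ => mul_nonneg (hl0 σ p hp) (coord_faceCenter_nonneg b σ j)
  have hzero : ∀ p ∈ K, ∀ j, b.coord j p = 0 → b.coord j (f p) = 0 := by
    intro p hp j hj
    rw [hfcoord p hp]
    refine Finset.sum_eq_zero fun σ _ => ?_
    rw [coord_faceCenter]
    split_ifs with hjσ
    · have : φ σ p = 0 := mul_eq_zero_of_right _ (Finset.prod_eq_zero hjσ hj)
      rw [this, zero_div, zero_mul]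
    · rw [mul_zero]
  have hfdiff : ∀ p ∈ K, ContDiffAt ℝ 1 f p := fun p hp =>
    ContDiffAt.sum fun σ _ => ((hφdiff σ).contDiffAt.div
      (ContDiff.sum fun τ _ => hφdiff τ).contDiffAt (hS p hp).ne').smul contDiffAt_const
  obtain ⟨p, hp, hfp⟩ := exists_mem_convexHull_eq_of_coord_eq_zero hmaps hzero hfdiff
    (y := center (faceCenter b)) (by
      rw [b.interior_convexHull]
      exact coord_center_pos b)
  have hsupp : ∀ σ ∈ Finset.univ, σ ∉ Finset.univ.filter (fun σ => φ σ p ≠ 0) → φ σ p = 0 :=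
    fun σ _ hσ => by simpa using hσ
  have hB1 : ∑ σ ∈ Finset.univ.filter (fun σ => φ σ p ≠ 0), φ σ p / S p = 1 := by
    rw [← hl1 p hp]
    exact Finset.sum_subset (Finset.subset_univ _) fun σ h h' => by rw [hsupp σ h h', zero_div]
  refine ⟨Finset.univ.filter fun σ => φ σ p ≠ 0, ⟨?_, fun σ => φ σ p / S p,
    fun σ _ => hl0 σ p hp, hB1, ?_⟩, s p hp, ?_⟩
  · exact Finset.nonempty_of_sum_ne_zero (hB1 ▸ one_ne_zero)
  · rw [← hfp]
    exact Finset.sum_subset (Finset.subset_univ _) fun σ h h' => by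
      simp only [hsupp σ h h', zero_div, zero_smul]
  · simp only [mem_iInter]
    intro σ hσ
    exact (hmemC σ p hp).1 (left_ne_zero_of_mul (Finset.mem_filter.1 hσ).2)

theorem nonempty_iInter_of_forall_thickening {X I : Type*} [MetricSpace X] [CompactSpace X]
    (C : I → Set X) (hC : ∀ i, IsClosed (C i)) (B : Finset I)
    (h : ∀ δ > 0, (⋂ i ∈ B, Metric.thickening δ (C i)).Nonempty) :
    (⋂ i ∈ B, C i).Nonempty := by
  let u : ℕ → ℝ := fun n => 1 / (n + 1)
  have hu : ∀ n, 0 < u n := fun n => Nat.one_div_pos_of_nat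
  have hclosed : ∀ n, IsClosed (⋂ i ∈ B, Metric.cthickening (u n) (C i)) := fun n =>
    isClosed_biInter fun i _ => Metric.isClosed_cthickening
  obtain ⟨p, hp⟩ := IsCompact.nonempty_iInter_of_sequence_nonempty_isCompact_isClosed
    (fun n => ⋂ i ∈ B, Metric.cthickening (u n) (C i))
    (fun n => iInter₂_mono fun i _ =>
      Metric.cthickening_mono (Nat.one_div_le_one_div n.le_succ) _)
    (fun n => (h (u n) (hu n)).mono
      (iInter₂_mono fun i _ => Metric.thickening_subset_cthickening _ _))
    (hclosed 0).isCompact hclosed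
  refine ⟨p, mem_iInter₂.2 fun i hi => ?_⟩
  rw [← (hC i).closure_eq, Metric.closure_eq_iInter_cthickening]
  refine mem_iInter₂.2 fun δ hδ => ?_
  obtain ⟨n, hn⟩ := exists_nat_one_div_lt hδ
  exact Metric.cthickening_mono hn.le _ (mem_iInter₂.1 (mem_iInter.1 hp n) i hi)

/-- The KKMS theorem for closed families. There are finitely many label sets, so if no balanced
intersection were nonempty, one `δ` would make all balanced intersections of the open
`δ`-thickenings empty. -/
theorem exists_isBalanced_of_isClosed {k : ℕ} {E : Type*} [NormedAddCommGroup E]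
    [InnerProductSpace ℝ E] [FiniteDimensional ℝ E] (b : AffineBasis (Fin (k + 1)) ℝ E)
    (C : NonemptySubset k → Set (Simplex k)) (hC : ∀ σ, IsClosed (C σ))
    (hface : ∀ J : Finset (Fin (k + 1)),
      face J ⊆ ⋃ σ : NonemptySubset k, ⋃ _ : σ.1 ⊆ J, C σ) :
    ∃ B : Finset (NonemptySubset k),
      IsBalanced (faceCenter b) B ∧ (⋂ σ ∈ B, C σ).Nonempty := by
  by_contra! hne
  have hδ : ∀ B, IsBalanced (faceCenter b) B →
      ∃ δ > 0, ¬(⋂ σ ∈ B, Metric.thickening δ (C σ)).Nonempty := by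
    intro B hB
    by_contra! h
    exact (nonempty_iInter_of_forall_thickening C hC B h).ne_empty (hne B hB)
  have hev : ∀ᶠ δ in 𝓝[>] (0 : ℝ), ∀ B, IsBalanced (faceCenter b) B →
      ¬(⋂ σ ∈ B, Metric.thickening δ (C σ)).Nonempty := by
    refine eventually_all.2 fun B => ?_
    by_cases hB : IsBalanced (faceCenter b) B
    · obtain ⟨δ, hδ0, hδB⟩ := hδ B hB
      filter_upwards [Ioo_mem_nhdsGT hδ0] with η hη _ hmem
      exact hδB (hmem.mono (iInter₂_mono fun σ _ => Metric.thickening_mono hη.2.le _))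
    · exact Eventually.of_forall fun δ h => absurd h hB
  obtain ⟨δ, hδ, hδ0⟩ := (hev.and self_mem_nhdsWithin).exists
  obtain ⟨B, hB, hmem⟩ := exists_isBalanced_of_isOpen b (fun σ => Metric.thickening δ (C σ))
    (fun σ => Metric.isOpen_thickening) fun J => (hface J).trans
      (iUnion₂_mono fun σ _ => Metric.self_subset_thickening hδ0 _)
  exact hδ B hB hmem

end KKMS

theorem corollary4p2 (k : ℕ) (x : Fin (k + 1) → EuclideanSpace ℝ (Fin k))
    (hx : AffineIndependent ℝ x)
    (C : KKMS.NonemptySubset k → Set (KKMS.Simplex k))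
    (hC : KKMS.IsCover C)
    (hface : ∀ J : Finset (Fin (k + 1)),
      KKMS.face J ⊆ ⋃ σ : KKMS.NonemptySubset k, ⋃ _ : σ.1 ⊆ J, C σ) :
    ∃ B : Finset (KKMS.NonemptySubset k),
      KKMS.IsBalanced (KKMS.faceCenter x) B ∧ (⋂ σ ∈ B, C σ).Nonempty := by
  let b : AffineBasis (Fin (k + 1)) ℝ (EuclideanSpace ℝ (Fin k)) :=
    ⟨x, hx, hx.affineSpan_eq_top_iff_card_eq_finrank_add_one.2 (by simp)⟩
  rcases hC.1 with h | h
  · exact KKMS.exists_isBalanced_of_isOpen b C h hface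
  · exact KKMS.exists_isBalanced_of_isClosed b C h hface
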